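/- Theorem. Let $d,\tilde d,m,M,k$ be nonnegative integers with $d\ge 8$ and $1\le\tilde d\le d$, and let $C\ge 1$ and $0<\beta,\gamma\le 1$ be real numbers. Consider the following Orthogonal Subspace Game in $\mathbb{R}^d$ (with the Euclidean norm). (1) The oracle samples a uniform $\tilde d$-dimensional linear subspace $E$ of $\mathbb{R}^d$ (normalized Haar measure on the Grassmannian) and, given $E$, i.i.d. vectors $v_1,\dots,v_m$ uniform on the unit sphere of $E$. (2) The player observes $E$ and $v_1,\dots,v_m$ and stores an $M$-bit message $\mathsf{Message}\in\{0,1\}^M$ about these. (3) Based on $\mathsf{Message}$ and $v_1,\dots,v_m$ only, the player returns unit vectors $y_1,\dots,y_k\in\mathbb{R}^d$. The player may be randomized: the message and output functions are measurable and may both use an internal random seed that is independent of $(E,v_1,\dots,v_m)$. The player wins if for every $i\in\{1,\dots,k\}$ $$\|\mathrm{Proj}_E(y_i)\|\le\beta\quad\text{and}\quad \|\mathrm{Proj}_{\mathrm{Span}(y_1,\dots,y_{i-1})^\perp}(y_i)\|\ge\gamma ,$$ where $\mathrm{Proj}$ denotes orthogonal projection. Assume that $$\frac{\gamma}{\beta}\ge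 12\sqrt{\frac{kd}{\tilde d}}\qquad\text{and}\qquad \frac{\tilde d}{4}\ge k\ge 50\,C\,\frac{M+2}{\tilde d}\,\ln\frac{\sqrt d}{\gamma}.$$ If the player wins the game with probability at least $1/C$, then $m\ge \tilde d/2$. -/

import Mathlib

open MeasureTheory
open scoped ENNReal

noncomputable section

namespace OrthogonalSubspaceGame

/-- `ℝ^d` with the Euclidean norm. -/
abbrev Vec (d : ℕ) : Type := EuclideanSpace ℝ (Fin d)

/-- The Grassmannian `Gr_n(ℝ^d)`: the `n`-dimensional linear subspaces of `ℝ^d`. -/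
def Gr (d n : ℕ) : Type := {E : Submodule ℝ (Vec d) // Module.finrank ℝ E = n}

/-- The usual topology of the Grassmannian: subspaces are identified with their orthogonal
projections. -/
instance (d n : ℕ) : TopologicalSpace (Gr d n) :=
  TopologicalSpace.induced (fun E : Gr d n => E.1.starProjection) inferInstance

/-- The Grassmannian carries its Borel σ-algebra. -/
instance (d n : ℕ) : MeasurableSpace (Gr d n) := borel (Gr d n)

instance (d n : ℕ) : BorelSpace (Gr d n) := ⟨rfl⟩

/-- The orthogonal group `O(d)`: the linear maps `U` of `ℝ^d` with `Uᵀ U = U Uᵀ = 1`. -/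
abbrev Orth (d : ℕ) : Type := unitary (Vec d →L[ℝ] Vec d)

instance (d : ℕ) : ContinuousStar (Vec d →L[ℝ] Vec d) :=
  ⟨(ContinuousLinearMap.adjoint (𝕜 := ℝ) (E := Vec d) (F := Vec d)).continuous⟩

instance (d : ℕ) : CompactSpace (Orth d) := by
  have hc : IsCompact ((unitary (Vec d →L[ℝ] Vec d) : Set (Vec d →L[ℝ] Vec d))) := by
    refine Metric.isCompact_of_isClosed_isBounded isClosed_unitary ?_
    refine (Metric.isBounded_closedBall (x := (0 : Vec d →L[ℝ] Vec d)) (r := 1)).subset ?_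
    intro u hu
    rw [mem_closedBall_zero_iff]
    refine ContinuousLinearMap.opNorm_le_bound _ zero_le_one fun x => ?_
    rw [one_mul]
    exact le_of_eq ((Unitary.linearIsometryEquiv ⟨u, hu⟩).norm_map x)
  exact isCompact_iff_compactSpace.mp hc

/-- The normalized Haar measure of the orthogonal group (total mass one). -/
def haarOrth (d : ℕ) : Measure (Orth d) := Measure.haarMeasure ⊤

instance (d : ℕ) : IsProbabilityMeasure (haarOrth d) :=
  ⟨by simpa [haarOrth] using
    Measure.haarMeasure_self (K₀ := (⊤ : TopologicalSpace.PositiveCompacts (Orth d)))⟩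

/-- The image of a subspace under an orthogonal map. -/
def rotate {d n : ℕ} (U : Orth d) (E : Gr d n) : Gr d n :=
  ⟨E.1.map (Unitary.linearIsometryEquiv U).toLinearEquiv.toLinearMap,
    (LinearEquiv.finrank_map_eq (Unitary.linearIsometryEquiv U).toLinearEquiv E.1).trans E.2⟩

theorem continuous_rotate {d n : ℕ} (E : Gr d n) : Continuous fun U : Orth d => rotate U E := by
  refine continuous_induced_rng.2 ?_
  have h : (fun U : Orth d => (rotate U E).1.starProjection) =
      fun U : Orth d => (U : Vec d →L[ℝ] Vec d) * E.1.starProjection *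
        star (U : Vec d →L[ℝ] Vec d) := by
    funext U
    ext1 x
    exact Submodule.starProjection_map_apply (Unitary.linearIsometryEquiv U) E.1 x
  refine (congrArg Continuous h).mpr ?_
  fun_prop

/-- The span of the first `n` vectors of the standard basis of `ℝ^d`. -/
def baseSubspace {d n : ℕ} (h : n ≤ d) : Gr d n :=
  ⟨Submodule.span ℝ (Set.range fun i : Fin n => EuclideanSpace.basisFun (Fin d) ℝ (Fin.castLE h i)),
    by
      have hli : LinearIndependent ℝ
          (fun i : Fin n => EuclideanSpace.basisFun (Fin d) ℝ (Fin.castLE h i)) :=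
        (EuclideanSpace.basisFun (Fin d) ℝ).orthonormal.linearIndependent.comp _
          (Fin.castLE_injective h)
      simpa using finrank_span_eq_card hli⟩

/-- The law of a uniform `n`-dimensional subspace of `ℝ^d`: the normalized Haar measure of the
Grassmannian, i.e. the law of `U E₀` for a Haar-distributed orthogonal `U` and a fixed `E₀`. -/
def uniformSubspace {d n : ℕ} (h : n ≤ d) : Measure (Gr d n) :=
  (haarOrth d).map fun U => rotate U (baseSubspace h)

instance {d n : ℕ} (h : n ≤ d) : IsProbabilityMeasure (uniformSubspace h) :=
  Measure.isProbabilityMeasure_map (continuous_rotate _).measurable.aemeasurable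

/-- The uniform distribution on the unit sphere of a subspace `E`: the normalized surface measure,
seen as a measure on `ℝ^d`. -/
def uniformSphere {d : ℕ} (E : Submodule ℝ (Vec d)) : Measure (Vec d) :=
  let σ : Measure (Metric.sphere (0 : E) 1) := (volume : Measure E).toSphere
  ((σ Set.univ)⁻¹ • σ).map fun x : Metric.sphere (0 : E) 1 => (x.1 : Vec d)

theorem isProbabilityMeasure_uniformSphere {d : ℕ} {E : Submodule ℝ (Vec d)} (h : E ≠ ⊥) :
    IsProbabilityMeasure (uniformSphere E) := by
  have : Nontrivial E := (Submodule.nontrivial_iff_ne_bot).2 h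
  have : IsProbabilityMeasure
      (((volume : Measure E).toSphere Set.univ)⁻¹ • (volume : Measure E).toSphere) :=
    ⟨by
      rw [Measure.smul_apply, smul_eq_mul]
      exact ENNReal.inv_mul_cancel
        (Measure.measure_univ_ne_zero.2 (Measure.toSphere_ne_zero (volume : Measure E)))
        (measure_ne_top _ _)⟩
  exact Measure.isProbabilityMeasure_map (by fun_prop)

/-- A strategy of the player, with internal randomness `ω` drawn from a probability space `Ω`
independently of the oracle. The message is a function of `ω`, the hidden subspace and the samples;
the output is a function of `ω`, the `M`-bit message and the samples only. -/
structure Strategy (Ω : Type*) [MeasurableSpace Ω] (d n m M k : ℕ) where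
  message : Ω → Gr d n → (Fin m → Vec d) → (Fin M → Bool)
  measurable_message :
    Measurable fun p : Ω × Gr d n × (Fin m → Vec d) => message p.1 p.2.1 p.2.2
  output : Ω → (Fin M → Bool) → (Fin m → Vec d) → (Fin k → Vec d)
  measurable_output :
    Measurable fun p : Ω × (Fin M → Bool) × (Fin m → Vec d) => output p.1 p.2.1 p.2.2
  norm_output : ∀ ω msg v i, ‖output ω msg v i‖ = 1

/-- The winning condition: every `y i` is `β`-nearly orthogonal to `E`, and the component of `y i`
orthogonal to the preceding vectors has norm at least `γ`. -/
def Wins {d k : ℕ} (β γ : ℝ) (E : Submodule ℝ (Vec d)) (y : Fin k → Vec d) : Prop :=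
  ∀ i, ‖E.starProjection (y i)‖ ≤ β ∧
    γ ≤ ‖(Submodule.span ℝ (y '' {j | j < i}))ᗮ.starProjection (y i)‖

/-- The probability that the player wins: `ω` is drawn from `P`, independently `E` is drawn
uniformly, and given `E` the samples `v` are i.i.d. uniform on the unit sphere of `E`. -/
def winProb {Ω : Type*} [MeasurableSpace Ω] (P : Measure Ω) {d n m M k : ℕ} (h : n ≤ d)
    (S : Strategy Ω d n m M k) (β γ : ℝ) : ℝ≥0∞ :=
  ∫⁻ ω, ∫⁻ E, (Measure.pi fun _ : Fin m => uniformSphere E.1)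
    {v | Wins β γ E.1 (S.output ω (S.message ω E v) v)} ∂(uniformSubspace h) ∂P

end OrthogonalSubspaceGame

end

namespace OrthogonalSubspaceGame

open ProbabilityTheory

/-! Fix the seed and one of the `2 ^ M` messages, so that the answer `y` depends on the samples
only. Write `E = U E₀` with `U` Haar and the samples as `U w`, with `w` in `E₀`; rotated back by
`U⁻¹`, a winning answer becomes a family `z` that is nearly orthogonal to `E₀` and robustly
independent. If `H` fixes `w`, replacing `U` by `U H` leaves the samples, hence the answer,
unchanged and replaces `z` by `H⁻¹ z`. With `2m ≤ n`, the space `F = (span w)ᗮ ⊓ E₀` has dimension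
`r ≥ n/2`, so much of `E₀` remains hidden.

This is quantified with `r` Gaussian vectors `G j`. For each `G`, `exists_rotation` gives an `H`
that fixes `w` and sends the parts of the `G j` orthogonal to `w` into `F`. A `z` nearly orthogonal
to `E₀` then makes `∑ ⟪H (G j), z i⟫²` small: a quadratic form of mean at most `4 k d β²` dominates
it, and Jensen bounds the mean of `exp (-μ ·)` from below. By Haar invariance `H` can be removed for
each fixed `G`; after exchanging the integrals, the Gaussian mean of `exp (-μ ∑ ⟪G j, z i⟫²)` is at
most `(2μγ²)^(-kr/2)`, since robust independence gives a triangular system with diagonal at least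
`γ`. Comparing the two bounds (`haarOrth_nearly_orthogonal_le`) with a suitable `μ` gives
probability at most `exp (-kn/4)` per message. The union bound `2 ^ M * exp (-kn/4)` is below `1/C`.
-/

/-! ### Integral inequalities: Jensen, triangular products, one Gaussian variable -/

/-- Jensen's inequality for `x ↦ exp (-x)`. -/
theorem exp_neg_le_integral_exp_neg {α : Type*} [MeasurableSpace α] {ν : Measure α}
    [IsProbabilityMeasure ν] {X : α → ℝ} {a : ℝ} (hX : Integrable X ν) (h0 : ∀ x, 0 ≤ X x)
    (ha : ∫ x, X x ∂ν ≤ a) : Real.exp (-a) ≤ ∫ x, Real.exp (-X x) ∂ν := by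
  have hexp : Integrable (fun x => Real.exp (-X x)) ν := by
    refine Integrable.of_bound
      (Real.continuous_exp.comp_aestronglyMeasurable hX.aestronglyMeasurable.neg) 1
      (Filter.Eventually.of_forall fun x => ?_)
    rw [Real.norm_of_nonneg (Real.exp_pos _).le]
    exact Real.exp_le_one_iff.2 (neg_nonpos.2 (h0 x))
  -- The tangent line of `exp (-·)` at `a` lies below the graph.
  have htan : ∀ x, Real.exp (-a) * (1 + a - X x) ≤ Real.exp (-X x) := fun x => by
    have h1 := Real.add_one_le_exp (a - X x)
    have h2 : Real.exp (-X x) = Real.exp (-a) * Real.exp (a - X x) := by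
      rw [← Real.exp_add]; ring_nf
    rw [h2]
    exact mul_le_mul_of_nonneg_left (by linarith) (Real.exp_pos _).le
  calc Real.exp (-a) ≤ Real.exp (-a) * (1 + a - ∫ x, X x ∂ν) :=
        le_mul_of_one_le_right (Real.exp_pos _).le (by linarith)
    _ = ∫ x, Real.exp (-a) * (1 + a - X x) ∂ν := by
        rw [integral_const_mul, integral_sub (integrable_const _) hX]
        simp
    _ ≤ ∫ x, Real.exp (-X x) ∂ν :=
        integral_mono (((integrable_const _).sub hX).const_mul _) hexp htan

/-- Iterated integration of a product whose factors depend on increasingly many coordinates. -/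
theorem lmarginal_prod_le {ι : Type*} [LinearOrder ι] (ν : ι → Measure ℝ)
    [∀ i, SigmaFinite (ν i)] (φ : ι → (ι → ℝ) → ℝ≥0∞) (hφ : ∀ i, Measurable (φ i))
    (hdep : ∀ i j, i < j → ∀ x t, φ i (Function.update x j t) = φ i x)
    (κ : ι → ℝ≥0∞) (hκ : ∀ i x, ∫⁻ t, φ i (Function.update x i t) ∂ν i ≤ κ i)
    (s : Finset ι) : ∀ x, lmarginal ν s (fun x => ∏ i ∈ s, φ i x) x ≤ ∏ i ∈ s, κ i := by
  induction s using Finset.induction_on_max with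
  | empty => intro x; simp
  | insert a s hs ih =>
    intro x
    have ha : a ∉ s := fun h => lt_irrefl _ (hs a h)
    rw [lmarginal_insert' _ (Finset.measurable_fun_prod _ fun i _ => hφ i) ha,
      Finset.prod_insert ha]
    -- The largest coordinate `a` enters only the factor `φ a`, so it is integrated first and the
    -- other factors come out.
    have hstep : (fun x => ∫⁻ t, ∏ i ∈ insert a s, φ i (Function.update x a t) ∂ν a) ≤
        fun x => κ a * ∏ i ∈ s, φ i x := by
      intro x
      have : ∀ t, ∏ i ∈ insert a s, φ i (Function.update x a t) =
          φ a (Function.update x a t) * ∏ i ∈ s, φ i x := fun t => by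
        rw [Finset.prod_insert ha]
        exact congrArg _ (Finset.prod_congr rfl fun i hi => hdep i a (hs i hi) x t)
      simp only [this]
      rw [lintegral_mul_const _
        (show Measurable fun t => φ a (Function.update x a t) from
          (hφ a).comp (measurable_update x))]
      gcongr
      exact hκ a x
    refine (lmarginal_mono hstep x).trans ?_
    have hm : Measurable fun x => ∏ i ∈ s, φ i x := Finset.measurable_fun_prod _ fun i _ => hφ i
    have : lmarginal ν s (fun x => κ a * ∏ i ∈ s, φ i x) x =
        κ a * lmarginal ν s (fun x => ∏ i ∈ s, φ i x) x := by
      simp only [lmarginal]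
      exact lintegral_const_mul _ (hm.comp measurable_updateFinset)
    rw [this]
    gcongr
    exact ih x

/-- A one-dimensional Gaussian anti-concentration bound. -/
theorem lintegral_gaussianReal_exp_neg_sq_le {μ γ c : ℝ} (a : ℝ) (hμ : 0 < μ) (hγ : 0 < γ)
    (hc : γ ≤ |c|) :
    ∫⁻ t, ENNReal.ofReal (Real.exp (-(μ * (a + c * t) ^ 2))) ∂gaussianReal 0 1 ≤
      ENNReal.ofReal (Real.sqrt (2 * μ * γ ^ 2))⁻¹ := by
  have hc0 : c ≠ 0 := abs_pos.1 (hγ.trans_le hc)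
  have hb : 0 < μ * c ^ 2 := by positivity
  have hform : ∀ t, Real.exp (-(μ * (a + c * t) ^ 2)) =
      Real.exp (-(μ * c ^ 2) * (t + a / c) ^ 2) := fun t => by
    congr 1; field_simp; ring
  have hint : Integrable fun t => Real.exp (-(μ * (a + c * t) ^ 2)) := by
    simp only [hform]
    exact (integrable_exp_neg_mul_sq hb).comp_add_right (a / c)
  have hval : ∫ t, Real.exp (-(μ * (a + c * t) ^ 2)) = Real.sqrt (Real.pi / (μ * c ^ 2)) := by
    simp only [hform]
    rw [integral_add_right_eq_self (fun t => Real.exp (-(μ * c ^ 2) * t ^ 2)) (a / c),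
      integral_gaussian]
  rw [gaussianReal_of_var_ne_zero _ one_ne_zero,
    lintegral_withDensity_eq_lintegral_mul _ (measurable_gaussianPDF _ _) (by fun_prop)]
  -- With the density replaced by its maximum, the integral is over Lebesgue measure and the shift
  -- `a` disappears by translation.
  have hpdf : ∀ t, gaussianPDF 0 1 t ≤ ENNReal.ofReal (Real.sqrt (2 * Real.pi))⁻¹ := fun t => by
    refine ENNReal.ofReal_le_ofReal ?_
    rw [gaussianPDFReal]
    simp only [NNReal.coe_one, mul_one]
    refine mul_le_of_le_one_right (by positivity) (Real.exp_le_one_iff.2 ?_)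
    rw [neg_div]
    exact neg_nonpos.2 (by positivity)
  calc _ ≤ ∫⁻ t, ENNReal.ofReal (Real.sqrt (2 * Real.pi))⁻¹ *
        ENNReal.ofReal (Real.exp (-(μ * (a + c * t) ^ 2))) :=
        lintegral_mono fun t => mul_le_mul_left (hpdf t) _
    _ = ENNReal.ofReal ((Real.sqrt (2 * Real.pi))⁻¹ * Real.sqrt (Real.pi / (μ * c ^ 2))) := by
        rw [lintegral_const_mul _ (by fun_prop),
          ← ofReal_integral_eq_lintegral_ofReal hint
            (Filter.Eventually.of_forall fun t => (Real.exp_pos _).le), hval,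
          ENNReal.ofReal_mul (by positivity)]
    _ ≤ _ := by
        refine ENNReal.ofReal_le_ofReal ?_
        rw [← Real.sqrt_inv, ← Real.sqrt_inv, ← Real.sqrt_mul (by positivity)]
        refine Real.sqrt_le_sqrt ?_
        have h1 : (2 * Real.pi)⁻¹ * (Real.pi / (μ * c ^ 2)) = (2 * μ * c ^ 2)⁻¹ := by
          field_simp
        rw [h1]
        have h2 : γ ^ 2 ≤ c ^ 2 := by
          rw [← sq_abs c]; exact pow_le_pow_left₀ hγ.le hc 2
        gcongr

/-! ### Robust independence and Gaussian anti-concentration -/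

/-- `γ`-robust linear independence: every vector is `γ`-far from the span of the preceding ones. -/
def Robust {E : Type*} [NormedAddCommGroup E] [NormedSpace ℝ E] {k : ℕ} (γ : ℝ)
    (y : Fin k → E) : Prop :=
  ∀ (i : Fin k) (c : Fin k → ℝ), γ ≤ ‖y i - ∑ j ∈ Finset.Iio i, c j • y j‖

/-- A robustly independent family has a triangular matrix with large diagonal in some orthonormal
basis. -/
theorem Robust.exists_orthonormalBasis {d k : ℕ} {γ : ℝ} (hγ : 0 < γ) {y : Fin k → Vec d}
    (hy : Robust γ y) (hkd : k ≤ d) :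
    ∃ b : OrthonormalBasis (Fin d) ℝ (Vec d), ∀ i : Fin k,
      γ ≤ |inner ℝ (b (Fin.castLE hkd i)) (y i)| ∧
        ∀ j, Fin.castLE hkd i < j → inner ℝ (b j) (y i) = 0 := by
  -- Padding by zeros to length `d` lets Gram–Schmidt produce a basis of the whole space. The
  -- diagonal entries are the norms of the unnormalized Gram–Schmidt vectors, each `y i` minus a
  -- combination of its predecessors.
  let f : Fin d → Vec d := fun i => if h : (i : ℕ) < k then y ⟨i, h⟩ else 0
  have hf : ∀ i : Fin k, f (Fin.castLE hkd i) = y i := fun i => by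
    simp [f]
  have hdim : Module.finrank ℝ (Vec d) = Fintype.card (Fin d) := by simp
  let b := InnerProductSpace.gramSchmidtOrthonormalBasis hdim f
  refine ⟨b, fun i => ⟨?_, fun j hij => ?_⟩⟩
  · set i' := Fin.castLE hkd i
    set g := InnerProductSpace.gramSchmidt ℝ f i' with hg
    have hdef := InnerProductSpace.gramSchmidt_def' ℝ f i'
    set v := ∑ j ∈ Finset.Iio i', (ℝ ∙ InnerProductSpace.gramSchmidt ℝ f j).starProjection (f i')
      with hv
    have hvmem : v ∈ Submodule.span ℝ (f '' Set.Iio i') := by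
      rw [← InnerProductSpace.span_gramSchmidt_Iio ℝ f i']
      refine Submodule.sum_mem _ fun j hj => ?_
      have hmem : InnerProductSpace.gramSchmidt ℝ f j ∈
          InnerProductSpace.gramSchmidt ℝ f '' Set.Iio i' := ⟨j, by simpa using hj, rfl⟩
      exact Submodule.span_mono (Set.singleton_subset_iff.2 hmem)
        (Submodule.starProjection_apply_mem _ _)
    have himg : f '' Set.Iio i' = y '' ((Finset.Iio i : Finset (Fin k)) : Set (Fin k)) := by
      ext x
      constructor
      · rintro ⟨j, hj, rfl⟩
        have hjk : (j : ℕ) < k := lt_trans (Fin.lt_def.1 hj) i.2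
        refine ⟨⟨j, hjk⟩, Finset.mem_coe.2 (Finset.mem_Iio.2 (Fin.lt_def.2 (Fin.lt_def.1 hj))), ?_⟩
        simp [f, hjk]
      · rintro ⟨j, hj, rfl⟩
        have hji : j < i := Finset.mem_Iio.1 (Finset.mem_coe.1 hj)
        exact ⟨Fin.castLE hkd j, Fin.lt_def.2 (Fin.lt_def.1 hji), hf j⟩
    rw [himg, Submodule.mem_span_image_finset_iff_exists_fun] at hvmem
    obtain ⟨c, hc⟩ := hvmem
    have hgn : γ ≤ ‖g‖ := by
      have hgv : g = y i - v := by
        rw [← hf i]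
        exact eq_sub_of_add_eq hdef.symm
      rw [hgv, ← hc]
      have := hy i fun j => if h : j ∈ Finset.Iio i then c ⟨j, h⟩ else 0
      rw [← Finset.sum_coe_sort] at this
      simpa [-Finset.univ_eq_attach, -Finset.mem_Iio, Subtype.coe_prop] using this
    have hg0 : g ≠ 0 := norm_pos_iff.1 (hγ.trans_le hgn)
    have hgn0 : InnerProductSpace.gramSchmidtNormed ℝ f i' ≠ 0 := by
      simp [InnerProductSpace.gramSchmidtNormed, ← hg, hg0]
    have hgv0 : inner ℝ g v = 0 := by
      rw [hv, inner_sum]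
      refine Finset.sum_eq_zero fun j hj => ?_
      obtain ⟨t, ht⟩ := Submodule.mem_span_singleton.1 (Submodule.starProjection_apply_mem
        (ℝ ∙ InnerProductSpace.gramSchmidt ℝ f j) (f i'))
      rw [← ht, inner_smul_right, hg,
        InnerProductSpace.gramSchmidt_orthogonal ℝ f (ne_of_gt (Finset.mem_Iio.1 hj)), mul_zero]
    have hb : inner ℝ (b i') (y i) = ‖g‖ := by
      have : b i' = InnerProductSpace.gramSchmidtNormed ℝ f i' :=
        InnerProductSpace.gramSchmidtOrthonormalBasis_apply hdim hgn0
      rw [this, InnerProductSpace.gramSchmidtNormed, ← hg, ← hf i, hdef, ← hg, inner_add_right,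
        real_inner_smul_left, real_inner_smul_left, hgv0, real_inner_self_eq_norm_sq]
      have := norm_ne_zero_iff.2 hg0
      simp
      field_simp
    rw [hb, abs_of_nonneg (norm_nonneg _)]
    exact hgn
  · rw [← hf i]
    exact InnerProductSpace.gramSchmidtOrthonormalBasis_inv_triangular hdim f hij

/-- Gaussian anti-concentration for a robustly independent family. -/
theorem Robust.lintegral_stdGaussian_le {d k : ℕ} {γ μ : ℝ} (hγ : 0 < γ) (hμ : 0 < μ)
    {y : Fin k → Vec d} (hy : Robust γ y) (hkd : k ≤ d) :
    ∫⁻ g, ENNReal.ofReal (Real.exp (-(μ * ∑ i, inner ℝ g (y i) ^ 2))) ∂stdGaussian (Vec d) ≤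
      ENNReal.ofReal ((Real.sqrt (2 * μ * γ ^ 2))⁻¹ ^ k) := by
  obtain ⟨b, hb⟩ := hy.exists_orthonormalBasis hγ hkd
  rw [stdGaussian_eq_map_pi_orthonormalBasis b, lintegral_map (by fun_prop) (by fun_prop)]
  -- In the triangular basis the `i`-th inner product involves the independent coordinates up to `i`
  -- only; the coordinates beyond `k` carry the trivial factor 1.
  let φ : Fin d → (Fin d → ℝ) → ℝ≥0∞ := fun i x => if h : (i : ℕ) < k then
    ENNReal.ofReal (Real.exp (-(μ * (∑ j, x j * inner ℝ (b j) (y ⟨i, h⟩)) ^ 2))) else 1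
  let κ : Fin d → ℝ≥0∞ := fun i => if (i : ℕ) < k then
    ENNReal.ofReal (Real.sqrt (2 * μ * γ ^ 2))⁻¹ else 1
  have hprod : ∀ (ψ : Fin k → ℝ≥0∞),
      ∏ i : Fin d, (if h : (i : ℕ) < k then ψ ⟨i, h⟩ else 1) = ∏ i, ψ i := fun ψ => by
    symm
    refine Finset.prod_of_injOn (Fin.castLE hkd) (Fin.castLE_injective hkd).injOn
      (fun _ _ => Finset.mem_coe.2 (Finset.mem_univ _)) (fun i _ hi => ?_) fun i _ => by simp
    rw [dif_neg]
    exact fun h => hi ⟨⟨i, h⟩, by simp, rfl⟩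
  have hφ : ∀ i, Measurable (φ i) := fun i => by
    by_cases h : (i : ℕ) < k
    · simp only [φ, h, dite_true]; fun_prop
    · simp only [φ, h, dite_false]; fun_prop
  have hupd : ∀ (x : Fin d → ℝ) (i : Fin d) (t : ℝ) (u : Vec d),
      ∑ j, Function.update x i t j * inner ℝ (b j) u =
        (∑ j ∈ Finset.univ.erase i, x j * inner ℝ (b j) u) + inner ℝ (b i) u * t := by
    intro x i t u
    rw [← Finset.sum_erase_add _ _ (Finset.mem_univ i), Function.update_self, mul_comm t]
    congr 1
    exact Finset.sum_congr rfl fun j hj => by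
      rw [Function.update_of_ne (Finset.ne_of_mem_erase hj)]
  have key := lmarginal_prod_le (fun _ : Fin d => gaussianReal 0 1) φ hφ
    (by
      intro i j hij x t
      by_cases h : (i : ℕ) < k
      · have h0 := (hb ⟨i, h⟩).2 j hij
        simp only [φ, h, dite_true]
        rw [hupd, h0, ← Finset.sum_erase_add _ _ (Finset.mem_univ j), h0]
        simp
      · simp [φ, h]) κ
    (by
      intro i x
      by_cases h : (i : ℕ) < k
      · simp only [φ, κ, h, dite_true, if_true, hupd]
        exact lintegral_gaussianReal_exp_neg_sq_le _ hμ hγ (hb ⟨i, h⟩).1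
      · simp [φ, κ, h]) Finset.univ 0
  rw [lmarginal_univ] at key
  have hκ : ∏ i, κ i = ENNReal.ofReal ((Real.sqrt (2 * μ * γ ^ 2))⁻¹ ^ k) := by
    have := hprod fun _ => ENNReal.ofReal (Real.sqrt (2 * μ * γ ^ 2))⁻¹
    rw [Finset.prod_const, Finset.card_univ, Fintype.card_fin,
      ← ENNReal.ofReal_pow (by positivity)] at this
    rw [← this]
    exact Finset.prod_congr rfl fun i _ => by simp [κ]
  rw [← hκ]
  refine le_trans (le_of_eq (lintegral_congr fun x => ?_)) key
  rw [hprod fun i => ENNReal.ofReal (Real.exp (-(μ * (∑ j, x j * inner ℝ (b j) (y i)) ^ 2))),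
    ← ENNReal.ofReal_prod_of_nonneg fun i _ => (Real.exp_pos _).le, ← Real.exp_sum,
    Finset.mul_sum, Finset.sum_neg_distrib]
  simp only [sum_inner, real_inner_smul_left]

/-- The law of `r` independent standard Gaussian vectors of `ℝ^d`. -/
noncomputable abbrev gaussianFamily (d r : ℕ) : Measure (Fin r → Vec d) :=
  Measure.pi fun _ => stdGaussian (Vec d)

/-- The exponential splits into one factor per Gaussian vector, and independence gives the `r`-th
power of the bound for a single vector. -/
theorem Robust.lintegral_gaussianFamily_le {d k : ℕ} (r : ℕ) {γ μ : ℝ} (hγ : 0 < γ) (hμ : 0 < μ)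
    {y : Fin k → Vec d} (hy : Robust γ y) (hkd : k ≤ d) :
    ∫⁻ G, ENNReal.ofReal (Real.exp (-(μ * ∑ i, ∑ j, inner ℝ (G j) (y i) ^ 2)))
      ∂gaussianFamily d r ≤ ENNReal.ofReal ((Real.sqrt (2 * μ * γ ^ 2))⁻¹ ^ (k * r)) := by
  let F : Vec d → ℝ≥0∞ := fun g => ENNReal.ofReal (Real.exp (-(μ * ∑ i, inner ℝ g (y i) ^ 2)))
  have hF : Measurable F := by fun_prop
  have hind : iIndepFun (fun (j : Fin r) (G : Fin r → Vec d) => F (G j)) (gaussianFamily d r) :=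
    iIndepFun_pi fun _ => hF.aemeasurable
  calc _ = ∫⁻ G : Fin r → Vec d, ∏ j, F (G j) ∂gaussianFamily d r := by
        refine lintegral_congr fun G => ?_
        rw [← ENNReal.ofReal_prod_of_nonneg fun i _ => (Real.exp_pos _).le, ← Real.exp_sum,
          Finset.sum_comm, Finset.mul_sum, Finset.sum_neg_distrib]
    _ = ∏ j, ∫⁻ G, F (G j) ∂gaussianFamily d r :=
        lintegral_prod_eq_prod_lintegral_of_indepFun Finset.univ _ hind
          fun j => hF.comp (measurable_pi_apply j)
    _ = (∫⁻ g, F g ∂stdGaussian (Vec d)) ^ r := by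
        have : ∀ j : Fin r, ∫⁻ G, F (G j) ∂gaussianFamily d r = ∫⁻ g, F g ∂stdGaussian (Vec d) :=
          fun j => (measurePreserving_eval (fun _ : Fin r => stdGaussian (Vec d)) j).lintegral_comp hF
        simp [this]
    _ ≤ _ := by
        rw [pow_mul, ENNReal.ofReal_pow (by positivity)]
        gcongr
        exact hy.lintegral_stdGaussian_le hγ hμ hkd

/-! ### Second moments of Gaussian families -/

theorem memLp_inner_gaussianFamily {d r : ℕ} (j : Fin r) (c : Vec d) :
    MemLp (fun G : Fin r → Vec d => inner ℝ c (G j)) 2 (gaussianFamily d r) := by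
  have := IsGaussian.memLp_dual (stdGaussian (Vec d)) (innerSL ℝ c) 2 (by simp)
  exact this.comp_measurePreserving (measurePreserving_eval _ j)

theorem integrable_sq_sum_inner {d r : ℕ} (c : Fin r → Vec d) :
    Integrable (fun G : Fin r → Vec d => (∑ j, inner ℝ (c j) (G j)) ^ 2)
      (gaussianFamily d r) :=
  (memLp_finsetSum _ fun j _ => memLp_inner_gaussianFamily j (c j)).integrable_sq

/-- The summands are independent and centred, so their variances `‖c j‖ ^ 2` add. -/
theorem integral_sq_sum_inner {d r : ℕ} (c : Fin r → Vec d) :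
    ∫ G : Fin r → Vec d, (∑ j, inner ℝ (c j) (G j)) ^ 2 ∂gaussianFamily d r =
      ∑ j, ‖c j‖ ^ 2 := by
  have hvar := variance_sum_pi (μ := fun _ : Fin r => stdGaussian (Vec d))
    (X := fun j => innerSL ℝ (c j))
    fun j => IsGaussian.memLp_dual (stdGaussian (Vec d)) (innerSL ℝ (c j)) 2 (by simp)
  simp only [variance_dual_stdGaussian, innerSL_apply_norm] at hvar
  have hsum : (∑ j, fun G : Fin r → Vec d => innerSL ℝ (c j) (G j)) =
      fun G => ∑ j, inner ℝ (c j) (G j) := by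
    ext G; simp
  have hmean : ∫ G : Fin r → Vec d, ∑ j, inner ℝ (c j) (G j) ∂gaussianFamily d r = 0 := by
    rw [integral_finsetSum _ fun j _ => (memLp_inner_gaussianFamily j (c j)).integrable (by simp)]
    refine Finset.sum_eq_zero fun j _ => ?_
    rw [integral_comp_eval (μ := fun _ : Fin r => stdGaussian (Vec d))
      (f := fun g => inner ℝ (c j) g) (by fun_prop)]
    exact integral_strongDual_stdGaussian (innerSL ℝ (c j))
  rw [hsum, variance_eq_sub (memLp_finsetSum _ fun j _ => memLp_inner_gaussianFamily j (c j)),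
    hmean] at hvar
  simpa using hvar

theorem integrable_sq_inner {d r : ℕ} (j : Fin r) (u : Vec d) :
    Integrable (fun G : Fin r → Vec d => inner ℝ (G j) u ^ 2) (gaussianFamily d r) := by
  simpa only [real_inner_comm] using (memLp_inner_gaussianFamily j u).integrable_sq

theorem integral_sq_inner {d r : ℕ} (j : Fin r) (u : Vec d) :
    ∫ G : Fin r → Vec d, inner ℝ (G j) u ^ 2 ∂gaussianFamily d r = ‖u‖ ^ 2 := by
  have := integral_sq_sum_inner (fun i : Fin r => if i = j then u else 0)
  simp only [apply_ite (inner ℝ), ite_apply] at this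
  rw [← Finset.sum_erase_add _ _ (Finset.mem_univ j), if_pos rfl,
    Finset.sum_eq_zero fun i hi => by rw [if_neg (Finset.ne_of_mem_erase hi)]; simp] at this
  rw [zero_add] at this
  rw [← this]
  refine integral_congr_ae (Filter.Eventually.of_forall fun G => ?_)
  simp only
  rw [Finset.sum_eq_single_of_mem j (Finset.mem_univ j)
    fun i _ hij => by rw [if_neg hij]; simp, if_pos rfl, real_inner_comm]

theorem norm_sq_sum_smul_eq {d r : ℕ} (η : Fin r → ℝ) (G : Fin r → Vec d) :
    ‖∑ j, η j • G j‖ ^ 2 =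
      ∑ p, (∑ j, inner ℝ (η j • EuclideanSpace.basisFun (Fin d) ℝ p) (G j)) ^ 2 := by
  rw [← (EuclideanSpace.basisFun (Fin d) ℝ).sum_sq_inner_right]
  refine Finset.sum_congr rfl fun p _ => ?_
  simp only [inner_sum, real_inner_smul_left, real_inner_smul_right]

theorem integrable_norm_sq_sum_smul {d r : ℕ} (η : Fin r → ℝ) :
    Integrable (fun G : Fin r → Vec d => ‖∑ j, η j • G j‖ ^ 2) (gaussianFamily d r) := by
  simp only [norm_sq_sum_smul_eq]
  exact integrable_finsetSum _ fun p _ => integrable_sq_sum_inner _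

theorem integral_norm_sq_sum_smul {d r : ℕ} (η : Fin r → ℝ) :
    ∫ G : Fin r → Vec d, ‖∑ j, η j • G j‖ ^ 2 ∂gaussianFamily d r = d * ∑ j, η j ^ 2 := by
  simp only [norm_sq_sum_smul_eq]
  rw [integral_finsetSum _ fun p _ => integrable_sq_sum_inner _]
  simp only [integral_sq_sum_inner, norm_smul, OrthonormalBasis.norm_eq_one, mul_one,
    Real.norm_eq_abs, sq_abs, Finset.sum_const, Finset.card_univ, Fintype.card_fin, nsmul_eq_mul]

/-- Jensen's inequality for the Gaussian quadratic form that dominates the rotated samples. -/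
theorem exp_neg_le_lintegral_gaussianFamily {d r k : ℕ} {μ a : ℝ} (hμ : 0 ≤ μ)
    (w : Fin k → Vec d) (η : Fin k → Fin r → ℝ)
    (ha : ∀ i, 2 * (r * ‖w i‖ ^ 2) + 2 * (d * ∑ j, η i j ^ 2) ≤ a) :
    ENNReal.ofReal (Real.exp (-(μ * (k * a)))) ≤
      ∫⁻ G, ENNReal.ofReal (Real.exp (-(μ * ∑ i, (2 * ∑ j, inner ℝ (G j) (w i) ^ 2 +
        2 * ‖∑ j, η i j • G j‖ ^ 2)))) ∂gaussianFamily d r := by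
  have h1 : ∀ i, Integrable (fun G : Fin r → Vec d => 2 * ∑ j, inner ℝ (G j) (w i) ^ 2)
      (gaussianFamily d r) := fun i =>
    (integrable_finsetSum _ fun j _ => integrable_sq_inner j (w i)).const_mul 2
  have h2 : ∀ i, Integrable (fun G : Fin r → Vec d => 2 * ‖∑ j, η i j • G j‖ ^ 2)
      (gaussianFamily d r) := fun i => (integrable_norm_sq_sum_smul (η i)).const_mul 2
  have h3 : Integrable (fun G : Fin r → Vec d => ∑ i, (2 * ∑ j, inner ℝ (G j) (w i) ^ 2 +
      2 * ‖∑ j, η i j • G j‖ ^ 2)) (gaussianFamily d r) :=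
    integrable_finsetSum _ fun i _ => (h1 i).add (h2 i)
  have hint := h3.const_mul μ
  have hval : ∫ G : Fin r → Vec d, μ * ∑ i, (2 * ∑ j, inner ℝ (G j) (w i) ^ 2 +
      2 * ‖∑ j, η i j • G j‖ ^ 2) ∂gaussianFamily d r ≤ μ * (k * a) := by
    rw [integral_const_mul, integral_finsetSum _ fun i _ => (h1 i).fun_add (h2 i)]
    refine mul_le_mul_of_nonneg_left ?_ hμ
    calc _ ≤ ∑ _i : Fin k, a := Finset.sum_le_sum fun i _ => by
          rw [integral_add (h1 i) (h2 i), integral_const_mul, integral_const_mul,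
            integral_norm_sq_sum_smul, integral_finsetSum _ fun j _ => integrable_sq_inner j (w i)]
          simpa only [integral_sq_inner, Finset.sum_const, Finset.card_univ, Fintype.card_fin,
            nsmul_eq_mul] using ha i
      _ = k * a := by simp
  refine (ENNReal.ofReal_le_ofReal (exp_neg_le_integral_exp_neg hint
    (fun G => by positivity) hval)).trans (le_of_eq ?_)
  refine ofReal_integral_eq_lintegral_ofReal ?_
    (Filter.Eventually.of_forall fun G => (Real.exp_pos _).le)
  refine Integrable.of_bound
    (Real.continuous_exp.comp_aestronglyMeasurable hint.aestronglyMeasurable.neg) 1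
    (Filter.Eventually.of_forall fun G => ?_)
  rw [Real.norm_of_nonneg (Real.exp_pos _).le]
  exact Real.exp_le_one_iff.2 (neg_nonpos.2 (by positivity))

/-! ### Gram matrices and the rotation fixing the samples -/

/-- Two families with the same Gram matrix differ by a linear isometry of the ambient space. -/
theorem exists_linearIsometryEquiv_of_inner_eq {ι V : Type*} [Fintype ι] [NormedAddCommGroup V]
    [InnerProductSpace ℝ V] [FiniteDimensional ℝ V] {u v : ι → V}
    (h : ∀ i j, inner ℝ (u i) (u j) = inner ℝ (v i) (v j)) :
    ∃ U : V ≃ₗᵢ[ℝ] V, ∀ i, U (u i) = v i := by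
  classical
  let lu := Fintype.linearCombination ℝ u
  let lv := Fintype.linearCombination ℝ v
  have hnorm : ∀ c, ‖lv c‖ = ‖lu c‖ := fun c => by
    rw [← sq_eq_sq₀ (norm_nonneg _) (norm_nonneg _), ← real_inner_self_eq_norm_sq,
      ← real_inner_self_eq_norm_sq]
    simp only [lu, lv, Fintype.linearCombination_apply, sum_inner, inner_sum, real_inner_smul_left,
      real_inner_smul_right, h]
  obtain ⟨g, hg⟩ := lu.rangeRestrict.exists_rightInverse_of_surjective
    (LinearMap.range_rangeRestrict lu)
  have hg' : ∀ s, lu (g s) = s := fun s => congrArg Subtype.val (LinearMap.congr_fun hg s)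
  -- Any linear section `g` of `lu` serves: by `hnorm`, `lv` vanishes on the kernel of `lu`.
  let L : LinearMap.range lu →ₗᵢ[ℝ] V :=
    { toLinearMap := lv ∘ₗ g
      norm_map' := fun s => by
        rw [LinearMap.comp_apply, hnorm, hg', Submodule.coe_norm] }
  refine ⟨L.extend.toLinearIsometryEquiv rfl, fun i => ?_⟩
  have hi : lu (Pi.single i 1) = u i := by simp [lu]
  have hvi : lv (Pi.single i 1) = v i := by simp [lv]
  have hmem : u i ∈ LinearMap.range lu := ⟨_, hi⟩
  have h1 : L.extend (u i) = lv (g ⟨u i, hmem⟩) := L.extend_apply ⟨u i, hmem⟩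
  rw [LinearIsometry.coe_toLinearIsometryEquiv, h1, ← hvi, ← sub_eq_zero, ← map_sub,
    ← norm_eq_zero, hnorm, map_sub, hg', hi, sub_self, norm_zero]

open scoped MatrixOrder in
/-- A Gram matrix has a symmetric square root. -/
theorem exists_symm_sq_eq_gram {r : ℕ} {V : Type*} [NormedAddCommGroup V] [InnerProductSpace ℝ V]
    (v : Fin r → V) : ∃ s : Matrix (Fin r) (Fin r) ℝ, (∀ i j, s i j = s j i) ∧
      ∀ i j, ∑ l, s i l * s l j = inner ℝ (v i) (v j) := by
  have hpos := (Matrix.posSemidef_gram ℝ v).nonneg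
  refine ⟨CFC.sqrt (Matrix.gram ℝ v), fun i j => ?_, fun i j => ?_⟩
  · have := (Matrix.nonneg_iff_posSemidef.1 (CFC.sqrt_nonneg (Matrix.gram ℝ v))).1.apply j i
    simpa using this
  · have := congrFun (congrFun (CFC.sqrt_mul_sqrt_self (Matrix.gram ℝ v) hpos) i) j
    rwa [Matrix.mul_apply, Matrix.gram_apply] at this

/-- Any `r` vectors can be rotated, fixing the samples, such that their components orthogonal to the
samples fall into `E`; the rotated vectors satisfy a bound by a quadratic form of the vectors. -/
theorem exists_rotation {d m r : ℕ} {w : Fin m → Vec d} {F : Submodule ℝ (Vec d)}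
    (hF : F ≤ (Submodule.span ℝ (Set.range w))ᗮ) (x : OrthonormalBasis (Fin r) ℝ F)
    (G : Fin r → Vec d) :
    ∃ h : Vec d ≃ₗᵢ[ℝ] Vec d, (∀ l, h (w l) = w l) ∧ ∀ y : Vec d,
      ∑ j, inner ℝ (h (G j)) y ^ 2 ≤
        2 * ∑ j, inner ℝ (G j) ((Submodule.span ℝ (Set.range w)).starProjection y) ^ 2 +
          2 * ‖∑ j, inner ℝ (x j : Vec d) y • G j‖ ^ 2 := by
  set W := Submodule.span ℝ (Set.range w) with hW
  let v : Fin r → Vec d := fun j => Wᗮ.starProjection (G j)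
  obtain ⟨s, hs, hss⟩ := exists_symm_sq_eq_gram v
  -- The columns of the root, read in the basis of `F`, have the Gram matrix of the `v j`. Both
  -- families are orthogonal to `W`, so one isometry can fix the samples and send `v` to `z`.
  let z : Fin r → Vec d := fun j => ∑ l, s l j • (x l : Vec d)
  have hwW : ∀ l, w l ∈ W := fun l => Submodule.subset_span ⟨l, rfl⟩
  have hv : ∀ j, v j ∈ Wᗮ := fun j => Submodule.starProjection_apply_mem _ _
  have hz : ∀ j, z j ∈ Wᗮ := fun j =>
    Submodule.sum_mem _ fun l _ => Submodule.smul_mem _ _ (hF (x l).2)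
  have hxx : ∀ i j, inner ℝ (x i : Vec d) (x j : Vec d) = if i = j then (1 : ℝ) else 0 :=
    fun i j => by
      have := orthonormal_iff_ite.1 x.orthonormal i j
      simpa using this
  have hzz : ∀ i j, inner ℝ (z i) (z j) = inner ℝ (v i) (v j) := fun i j => by
    rw [← hss i j]
    simp only [z, sum_inner, inner_sum, real_inner_smul_left, real_inner_smul_right, hxx]
    simp [hs _ i, mul_comm]
  obtain ⟨h, hh⟩ := exists_linearIsometryEquiv_of_inner_eq (u := Sum.elim w v) (v := Sum.elim w z)
    (by
      rintro (i | i) (j | j)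
      · rfl
      · simp only [Sum.elim_inl, Sum.elim_inr]
        rw [hv j _ (hwW i), hz j _ (hwW i)]
      · simp only [Sum.elim_inl, Sum.elim_inr]
        rw [real_inner_comm, hv i _ (hwW j), real_inner_comm, hz i _ (hwW j)]
      · exact (hzz i j).symm)
  have hw : ∀ l, h (w l) = w l := fun l => hh (Sum.inl l)
  have hhv : ∀ j, h (v j) = z j := fun j => hh (Sum.inr j)
  have hWfix : ∀ a ∈ W, h a = a := fun a ha => by
    induction ha using Submodule.span_induction with
    | mem a ha => obtain ⟨l, rfl⟩ := ha; exact hw l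
    | zero => simp
    | add a b _ _ ha hb => rw [map_add, ha, hb]
    | smul c a _ ha => rw [map_smul, ha]
  refine ⟨h, hw, fun y => ?_⟩
  have hsplit : ∀ j, inner ℝ (h (G j)) y = inner ℝ (G j) (W.starProjection y) + inner ℝ (z j) y :=
    fun j => by
      have : G j = W.starProjection (G j) + v j :=
        (Submodule.starProjection_add_starProjection_orthogonal (K := W) (G j)).symm
      conv_lhs => rw [this]
      rw [map_add, hhv, hWfix _ (Submodule.starProjection_apply_mem _ _), inner_add_left,
        Submodule.inner_starProjection_left_eq_right]
  let η : Fin r → ℝ := fun l => inner ℝ (x l : Vec d) y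
  -- Symmetry of the root matters here: the left side is `ηᵀ s sᵀ η`, and `s sᵀ = s²` is the Gram
  -- matrix of `v`. Hence the root drops out of the final bound.
  have hzy : ∑ j, inner ℝ (z j) y ^ 2 = ‖∑ j, η j • v j‖ ^ 2 := by
    have h1 : ∀ j, inner ℝ (z j) y = ∑ l, s l j * η l := fun j => by
      simp only [z, sum_inner, real_inner_smul_left, η]
    calc ∑ l, inner ℝ (z l) y ^ 2 = ∑ l, ∑ i, ∑ j, s i l * η i * (s j l * η j) := by
          simp only [h1, sq, Finset.sum_mul_sum]
      _ = ∑ i, ∑ j, ∑ l, s i l * η i * (s j l * η j) := by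
          rw [Finset.sum_comm]
          exact Finset.sum_congr rfl fun i _ => Finset.sum_comm
      _ = ∑ i, ∑ j, η i * (η j * inner ℝ (v i) (v j)) :=
          Finset.sum_congr rfl fun i _ => Finset.sum_congr rfl fun j _ => by
            rw [← hss, Finset.mul_sum, Finset.mul_sum]
            exact Finset.sum_congr rfl fun l _ => by rw [hs l j]; ring
      _ = ‖∑ j, η j • v j‖ ^ 2 := by
          rw [← real_inner_self_eq_norm_sq]
          simp only [sum_inner, inner_sum, real_inner_smul_left, real_inner_smul_right]
          rw [Finset.sum_comm]
          refine Finset.sum_congr rfl fun i _ => Finset.sum_congr rfl fun j _ => ?_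
          rw [real_inner_comm]; ring
  have hproj : ‖∑ j, η j • v j‖ ≤ ‖∑ j, η j • G j‖ := by
    have : ∑ j, η j • v j = Wᗮ.starProjection (∑ j, η j • G j) := by
      simp [v, map_sum, map_smul]
    rw [this]
    exact Submodule.norm_starProjection_apply_le _ _
  calc ∑ j, inner ℝ (h (G j)) y ^ 2
      ≤ ∑ j, (2 * inner ℝ (G j) (W.starProjection y) ^ 2 + 2 * inner ℝ (z j) y ^ 2) :=
        Finset.sum_le_sum fun j _ => by
          rw [hsplit]
          linarith [add_sq_le (a := inner ℝ (G j) (W.starProjection y)) (b := inner ℝ (z j) y)]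
    _ = 2 * ∑ j, inner ℝ (G j) (W.starProjection y) ^ 2 + 2 * ‖∑ j, η j • v j‖ ^ 2 := by
        rw [Finset.sum_add_distrib, ← Finset.mul_sum, ← Finset.mul_sum, hzy]
    _ ≤ _ := by gcongr

theorem norm_starProjection_le_of_le {d : ℕ} {V E : Submodule ℝ (Vec d)} (h : V ≤ E) (y : Vec d) :
    ‖V.starProjection y‖ ≤ ‖E.starProjection y‖ := by
  have : V.starProjection (E.starProjection y) = V.starProjection y :=
    congrFun (congrArg DFunLike.coe (Submodule.starProjection_comp_starProjection_of_le h)) y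
  rw [← this]
  exact Submodule.norm_starProjection_apply_le _ _

theorem sum_sq_inner_eq_norm_sq_starProjection {d r : ℕ} {F : Submodule ℝ (Vec d)}
    (x : OrthonormalBasis (Fin r) ℝ F) (y : Vec d) :
    ∑ j, inner ℝ (x j : Vec d) y ^ 2 = ‖F.starProjection y‖ ^ 2 := by
  have h1 : ∀ j, inner ℝ (x j : Vec d) y = inner ℝ (x j) (F.orthogonalProjectionOnto y) := fun j => by
    rw [Submodule.inner_orthogonalProjectionOnto_eq_of_mem_left]
  simp only [h1]
  rw [x.sum_sq_inner_right]
  rfl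

/-! ### Rotation invariance of the oracle's distribution -/

open scoped Pointwise in
/-- The surface measure of the unit sphere is equivariant under linear isometries. -/
theorem map_toSphere_volume {E F : Type*} [NormedAddCommGroup E] [InnerProductSpace ℝ E]
    [FiniteDimensional ℝ E] [MeasurableSpace E] [BorelSpace E] [NormedAddCommGroup F]
    [InnerProductSpace ℝ F] [FiniteDimensional ℝ F] [MeasurableSpace F] [BorelSpace F]
    (e : E ≃ₗᵢ[ℝ] F) (φ : Metric.sphere (0 : E) 1 → Metric.sphere (0 : F) 1)
    (hφ : ∀ x, (φ x : F) = e x) :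
    (volume : Measure E).toSphere.map φ = (volume : Measure F).toSphere := by
  have hm : Measurable φ := by
    refine Measurable.subtype_mk (f := fun x => (φ x : F)) ?_
    simp only [hφ]
    fun_prop
  ext s hs
  rw [Measure.map_apply hm hs, Measure.toSphere_apply' _ (hm hs), Measure.toSphere_apply' _ hs,
    e.toLinearEquiv.finrank_eq]
  congr 1
  -- Surface measure is defined by the volume of the cone over a set, and isometries carry cones to
  -- cones and preserve volume.
  have hset : Set.Ioo (0 : ℝ) 1 • ((fun x : Metric.sphere (0 : E) 1 => (x : E)) '' (φ ⁻¹' s)) =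
      e ⁻¹' (Set.Ioo (0 : ℝ) 1 • ((fun x : Metric.sphere (0 : F) 1 => (x : F)) '' s)) := by
    ext y
    simp only [Set.mem_preimage, Set.mem_smul]
    constructor
    · rintro ⟨t, ht, _, ⟨x, hx, rfl⟩, rfl⟩
      exact ⟨t, ht, _, ⟨φ x, hx, rfl⟩, by simp [hφ]⟩
    · rintro ⟨t, ht, _, ⟨x, hx, rfl⟩, hy⟩
      have hx1 : ‖e.symm (x : F)‖ = 1 := by
        rw [LinearIsometryEquiv.norm_map]; exact mem_sphere_zero_iff_norm.1 x.2
      refine ⟨t, ht, _, ⟨⟨e.symm x, mem_sphere_zero_iff_norm.2 hx1⟩, ?_, rfl⟩, ?_⟩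
      · have : φ ⟨e.symm x, mem_sphere_zero_iff_norm.2 hx1⟩ = x := Subtype.ext (by simp [hφ])
        rw [Set.mem_preimage, this]; exact hx
      · apply e.injective
        simp only [map_smul, LinearIsometryEquiv.apply_symm_apply]
        exact hy
  exact (congrArg volume hset).trans
    (e.measurePreserving.measure_preimage_equiv (f := e.toHomeomorph.toMeasurableEquiv) _)

theorem uniformSphere_map {d : ℕ} (E : Submodule ℝ (Vec d)) (U : Vec d ≃ₗᵢ[ℝ] Vec d) :
    uniformSphere (E.map U.toLinearEquiv.toLinearMap) = (uniformSphere E).map U := by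
  let e : E ≃ₗᵢ[ℝ] E.map U.toLinearEquiv.toLinearMap :=
    { U.toLinearEquiv.submoduleMap E with
      norm_map' := fun x => U.norm_map x }
  have he : ∀ x, (e x : Vec d) = U x := fun x => rfl
  let φ : Metric.sphere (0 : E) 1 → Metric.sphere (0 : E.map U.toLinearEquiv.toLinearMap) 1 :=
    fun x => ⟨e x, mem_sphere_zero_iff_norm.2
      ((e.norm_map x).trans (mem_sphere_zero_iff_norm.1 x.2))⟩
  have hm : Measurable φ := by
    refine Measurable.subtype_mk ?_
    fun_prop
  have hmap := map_toSphere_volume e φ fun _ => rfl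
  simp only [uniformSphere]
  rw [← hmap, Measure.map_apply hm MeasurableSet.univ, Set.preimage_univ, Measure.map_smul,
    Measure.map_smul, Measure.map_smul, Measure.map_map (by fun_prop) hm,
    Measure.map_map (by fun_prop) (by fun_prop)]
  rfl

/-- A right translate is again a Haar probability measure, and there is only one. The right-hand
side is needed because rotations fixing `w` act before `U`. -/
instance isMulRightInvariant_haarOrth (d : ℕ) : (haarOrth d).IsMulRightInvariant := by
  have : (haarOrth d).IsHaarMeasure := by unfold haarOrth; infer_instance
  refine ⟨fun g => ?_⟩
  have hp : IsProbabilityMeasure ((haarOrth d).map (· * g)) :=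
    Measure.isProbabilityMeasure_map (by fun_prop)
  exact Measure.isHaarMeasure_eq_of_isProbabilityMeasure _ _

/-- Change of variables `E = U E₀`, `v = U w`. An inequality suffices, and it requires no
measurability of `A`: `lintegral_map_le` holds for any integrand, and the rotation of the samples is
a measurable equivalence. -/
theorem lintegral_uniformSubspace_le {d n : ℕ} (hn : n ≤ d) (hn1 : 1 ≤ n) {m : ℕ}
    (A : Submodule ℝ (Vec d) → Set (Fin m → Vec d)) :
    ∫⁻ E, (Measure.pi fun _ : Fin m => uniformSphere E.1) (A E.1) ∂uniformSubspace hn ≤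
      ∫⁻ U, (Measure.pi fun _ : Fin m => uniformSphere (baseSubspace hn).1)
        {w | (fun l => Unitary.linearIsometryEquiv U (w l)) ∈ A (rotate U (baseSubspace hn)).1}
        ∂haarOrth d := by
  refine (lintegral_map_le _ _).trans (lintegral_mono fun U => ?_)
  have hne : ∀ E : Gr d n, E.1 ≠ ⊥ := fun E h => by
    have := E.2
    rw [h, finrank_bot] at this
    omega
  have hp := isProbabilityMeasure_uniformSphere (hne (baseSubspace hn))
  let V := Unitary.linearIsometryEquiv U
  have hp' : IsProbabilityMeasure ((uniformSphere (baseSubspace hn).1).map V) :=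
    Measure.isProbabilityMeasure_map (by fun_prop)
  have hpi := Measure.pi_map_pi (μ := fun _ : Fin m => uniformSphere (baseSubspace hn).1)
    (f := fun _ => V) fun _ => by fun_prop
  have hrot : uniformSphere (rotate U (baseSubspace hn)).1 =
      (uniformSphere (baseSubspace hn).1).map V := uniformSphere_map _ _
  simp only [hrot]
  rw [← hpi]
  let Φ : (Fin m → Vec d) ≃ᵐ (Fin m → Vec d) :=
    MeasurableEquiv.piCongrRight fun _ => V.toHomeomorph.toMeasurableEquiv
  exact (Φ.map_apply _).le

theorem ae_mem_of_pi_uniformSphere {d m : ℕ} {E : Submodule ℝ (Vec d)} (hE : E ≠ ⊥) :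
    ∀ᵐ w ∂(Measure.pi fun _ : Fin m => uniformSphere E), ∀ l, w l ∈ E := by
  have hp := isProbabilityMeasure_uniformSphere hE
  rw [ae_all_iff]
  intro l
  have h1 : ∀ᵐ x ∂uniformSphere E, x ∈ E := by
    simp only [uniformSphere]
    refine (ae_map_iff (p := fun x => x ∈ E) (Measurable.aemeasurable (by fun_prop))
      (Submodule.closed_of_finiteDimensional E).measurableSet).2 ?_
    exact Filter.Eventually.of_forall fun x => x.1.2
  exact (Measure.quasiMeasurePreserving_eval (fun _ : Fin m => uniformSphere E) l).ae h1

/-! ### Closedness and invariance of the winning condition -/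

theorem isClosed_setOf_robust {d k : ℕ} (γ : ℝ) :
    IsClosed {y : Fin k → Vec d | Robust γ y} := by
  simp only [Robust, Set.ofPred_forall]
  exact isClosed_iInter fun i => isClosed_iInter fun c =>
    isClosed_le continuous_const (by fun_prop)

theorem isClosed_setOf_nearly_orthogonal_robust {d k : ℕ} (E : Submodule ℝ (Vec d)) (β γ : ℝ) :
    IsClosed {y : Fin k → Vec d | (∀ i, ‖E.starProjection (y i)‖ ≤ β) ∧ Robust γ y} := by
  have h : {y : Fin k → Vec d | (∀ i, ‖E.starProjection (y i)‖ ≤ β) ∧ Robust γ y} =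
      (⋂ i, {y | ‖E.starProjection (y i)‖ ≤ β}) ∩ {y | Robust γ y} := by
    ext y; simp
  rw [h]
  refine IsClosed.inter ?_ (isClosed_setOf_robust γ)
  exact isClosed_iInter fun i => isClosed_le (by fun_prop) continuous_const

theorem Robust.map {d k : ℕ} {γ : ℝ} {y : Fin k → Vec d} (hy : Robust γ y)
    (U : Vec d ≃ₗᵢ[ℝ] Vec d) : Robust γ fun i => U (y i) := fun i c => by
  simp only [← map_smul, ← map_sum, ← map_sub, LinearIsometryEquiv.norm_map]
  exact hy i c

/-- Projecting off the preceding vectors kills any combination of them and does not increase norms.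
-/
theorem Wins.robust {d k : ℕ} {β γ : ℝ} {E : Submodule ℝ (Vec d)} {y : Fin k → Vec d}
    (h : Wins β γ E y) : Robust γ y := fun i c => by
  refine (h i).2.trans ?_
  set S := Submodule.span ℝ (y '' {j | j < i})
  have hmem : ∑ j ∈ Finset.Iio i, c j • y j ∈ S :=
    Submodule.sum_mem _ fun j hj => Submodule.smul_mem _ _
      (Submodule.subset_span ⟨j, Finset.mem_Iio.1 hj, rfl⟩)
  have h0 : Sᗮ.starProjection (∑ j ∈ Finset.Iio i, c j • y j) = 0 :=
    Submodule.starProjection_orthogonal_apply_eq_zero hmem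
  have : Sᗮ.starProjection (y i) = Sᗮ.starProjection (y i - ∑ j ∈ Finset.Iio i, c j • y j) := by
    rw [map_sub, h0, sub_zero]
  rw [this]
  exact Submodule.norm_starProjection_apply_le _ _

/-! ### Answers in the coordinates of the fixed subspace -/

/-- The player's answer to the rotated samples, rotated back. -/
noncomputable def pulledBack {d m k : ℕ} (y : (Fin m → Vec d) → Fin k → Vec d) (U : Orth d)
    (w : Fin m → Vec d) : Fin k → Vec d := fun i =>
  (Unitary.linearIsometryEquiv U).symm (y (fun l => Unitary.linearIsometryEquiv U (w l)) i)

theorem measurable_pulledBack {d m k : ℕ} {y : (Fin m → Vec d) → Fin k → Vec d}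
    (hy : Measurable y) :
    Measurable fun p : Orth d × (Fin m → Vec d) => pulledBack y p.1 p.2 := by
  have hv : Measurable fun p : Orth d × (Fin m → Vec d) =>
      fun l => (p.1 : Vec d →L[ℝ] Vec d) (p.2 l) := by
    refine Continuous.measurable ?_
    fun_prop
  have happ : Measurable fun q : (Vec d →L[ℝ] Vec d) × Vec d => q.1 q.2 :=
    Continuous.measurable (by fun_prop)
  have hstar : Measurable fun p : Orth d × (Fin m → Vec d) =>
      star (p.1 : Vec d →L[ℝ] Vec d) := Continuous.measurable (by fun_prop)
  refine measurable_pi_lambda _ fun i => ?_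
  exact happ.comp (hstar.prodMk ((measurable_pi_apply i).comp (hy.comp hv)))

/-- The player sees `U H w = U w` and so gives the same answer; only the rotation back changes. -/
theorem pulledBack_mul {d m k : ℕ} (y : (Fin m → Vec d) → Fin k → Vec d) (U H : Orth d)
    (w : Fin m → Vec d) (hw : ∀ l, Unitary.linearIsometryEquiv H (w l) = w l) (i : Fin k) :
    pulledBack y (U * H) w i = (Unitary.linearIsometryEquiv H).symm (pulledBack y U w i) := by
  have h1 : ∀ x, Unitary.linearIsometryEquiv (U * H) x =
      Unitary.linearIsometryEquiv U (Unitary.linearIsometryEquiv H x) := fun x => rfl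
  simp only [pulledBack, h1, hw]
  rw [LinearIsometryEquiv.symm_apply_eq, h1, LinearIsometryEquiv.apply_symm_apply,
    LinearIsometryEquiv.apply_symm_apply]

theorem robust_pulledBack_mul {d m k : ℕ} {γ : ℝ} (y : (Fin m → Vec d) → Fin k → Vec d)
    (U H : Orth d) (w : Fin m → Vec d) (hw : ∀ l, Unitary.linearIsometryEquiv H (w l) = w l) :
    Robust γ (pulledBack y (U * H) w) ↔ Robust γ (pulledBack y U w) := by
  have h := pulledBack_mul y U H w hw
  constructor
  · intro hR
    have := hR.map (Unitary.linearIsometryEquiv H)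
    simpa only [h, LinearIsometryEquiv.apply_symm_apply] using this
  · intro hR
    have := hR.map (Unitary.linearIsometryEquiv H).symm
    simpa only [← h] using this

/-! ### The probability bound for fixed samples and a fixed message -/

/-- For fixed samples, a robustly independent answer is rarely almost orthogonal to the rotated
subspace. -/
theorem haarOrth_nearly_orthogonal_le {d m k r : ℕ} {β γ μ : ℝ} (hγ : 0 < γ) (hμ : 0 < μ)
    (hkd : k ≤ d) {E : Submodule ℝ (Vec d)} {w : Fin m → Vec d} (hw : ∀ l, w l ∈ E)
    (hr : Module.finrank ℝ ↥((Submodule.span ℝ (Set.range w))ᗮ ⊓ E) = r)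
    {y : (Fin m → Vec d) → Fin k → Vec d} (hy : Measurable y) :
    haarOrth d {U | (∀ i, ‖E.starProjection (pulledBack y U w i)‖ ≤ β) ∧
      Robust γ (pulledBack y U w)} ≤
    ENNReal.ofReal (Real.exp (μ * (k * (4 * d * β ^ 2))) *
      (Real.sqrt (2 * μ * γ ^ 2))⁻¹ ^ (k * r)) := by
  set W := Submodule.span ℝ (Set.range w)
  set F := Wᗮ ⊓ E
  have hWE : W ≤ E := Submodule.span_le.2 (by rintro _ ⟨l, rfl⟩; exact hw l)
  have hrd : r ≤ d := by
    rw [← hr]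
    simpa using Submodule.finrank_le F
  obtain ⟨x⟩ : Nonempty (OrthonormalBasis (Fin r) ℝ F) :=
    ⟨(stdOrthonormalBasis ℝ F).reindex (finCongr hr)⟩
  let z : Orth d → Fin k → Vec d := fun U => pulledBack y U w
  have hz : Measurable z := by
    have h := Measurable.comp (measurable_pulledBack hy) (measurable_prodMk_right (y := w))
    exact h
  have hzi : ∀ i, Measurable fun U => z U i := fun i => (measurable_pi_apply i).comp hz
  let R : Set (Orth d) := {U | Robust γ (z U)}
  have hR : MeasurableSet R := hz (isClosed_setOf_robust γ).measurableSet
  -- Only robustness is kept as a weight: it is unchanged under `U ↦ U H`, whereas near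
  -- orthogonality to `E` is used up in `hjensen`.
  let ρ : Orth d → ℝ≥0∞ := R.indicator 1
  have hρ : Measurable ρ := measurable_one.indicator hR
  let A : Set (Orth d) := {U | (∀ i, ‖E.starProjection (z U i)‖ ≤ β) ∧ Robust γ (z U)}
  let q : Orth d → (Fin r → Vec d) → ℝ := fun U G =>
    ∑ i, (2 * ∑ j, inner ℝ (G j) (W.starProjection (z U i)) ^ 2 +
      2 * ‖∑ j, inner ℝ (x j : Vec d) (z U i) • G j‖ ^ 2)
  let p : Orth d → (Fin r → Vec d) → ℝ := fun U G =>
    ∑ i, ∑ j, inner ℝ (G j) (z U i) ^ 2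
  have hq : Measurable (Function.uncurry q) := by
    simp only [q, Function.uncurry_def]
    have : ∀ i, Measurable fun a : Orth d × (Fin r → Vec d) => z a.1 i :=
      fun i => (hzi i).comp measurable_fst
    fun_prop
  have hp : Measurable (Function.uncurry p) := by
    simp only [p, Function.uncurry_def]
    have : ∀ i, Measurable fun a : Orth d × (Fin r → Vec d) => z a.1 i :=
      fun i => (hzi i).comp measurable_fst
    fun_prop
  have hmeas : ∀ s : Orth d → (Fin r → Vec d) → ℝ, Measurable (Function.uncurry s) →
      Measurable (Function.uncurry fun U G => ρ U * ENNReal.ofReal (Real.exp (-(μ * s U G)))) :=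
    fun s hs => by
      simp only [Function.uncurry_def] at hs ⊢
      have : Measurable fun a : Orth d × (Fin r → Vec d) => ρ a.1 := hρ.comp measurable_fst
      fun_prop
  have hsec : ∀ s : Orth d → (Fin r → Vec d) → ℝ, Measurable (Function.uncurry s) → ∀ U,
      Measurable fun G => ENNReal.ofReal (Real.exp (-(μ * s U G))) := fun s hs U => by
    have : Measurable (s U) := hs.comp measurable_prodMk_left
    fun_prop
  have hjensen : ∀ U, A.indicator 1 U * ENNReal.ofReal (Real.exp (-(μ * (k * (4 * d * β ^ 2))))) ≤
      ∫⁻ G, ρ U * ENNReal.ofReal (Real.exp (-(μ * q U G))) ∂gaussianFamily d r := fun U => by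
    rw [lintegral_const_mul _ (hsec q hq U)]
    by_cases hU : U ∈ A
    · rw [Set.indicator_of_mem hU, show ρ U = 1 from Set.indicator_of_mem (s := R) hU.2 1,
        Pi.one_apply, one_mul, one_mul]
      refine exp_neg_le_lintegral_gaussianFamily hμ.le (fun i => W.starProjection (z U i))
        (fun i j => inner ℝ (x j : Vec d) (z U i)) fun i => ?_
      rw [sum_sq_inner_eq_norm_sq_starProjection]
      have h1 : ‖W.starProjection (z U i)‖ ^ 2 ≤ β ^ 2 := pow_le_pow_left₀ (norm_nonneg _)
        ((norm_starProjection_le_of_le hWE _).trans (hU.1 i)) 2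
      have h2 : ‖F.starProjection (z U i)‖ ^ 2 ≤ β ^ 2 := pow_le_pow_left₀ (norm_nonneg _)
        ((norm_starProjection_le_of_le inf_le_right _).trans (hU.1 i)) 2
      have h3 : (r : ℝ) ≤ d := Nat.cast_le.2 hrd
      have h4 : (r : ℝ) * ‖W.starProjection (z U i)‖ ^ 2 ≤ d * β ^ 2 := by gcongr
      have h5 : (d : ℝ) * ‖F.starProjection (z U i)‖ ^ 2 ≤ d * β ^ 2 := by gcongr
      linarith
    · rw [Set.indicator_of_notMem hU, zero_mul]
      exact zero_le
  -- The rotation depends on `G` but not on `U`; for fixed `G`, right invariance of Haar measure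
  -- therefore absorbs it.
  have hrot : ∀ G : Fin r → Vec d,
      ∫⁻ U, ρ U * ENNReal.ofReal (Real.exp (-(μ * q U G))) ∂haarOrth d ≤
        ∫⁻ U, ρ U * ENNReal.ofReal (Real.exp (-(μ * p U G))) ∂haarOrth d := fun G => by
    obtain ⟨h, hfix, hle⟩ := exists_rotation (w := w) (F := F) inf_le_left x G
    let H : Orth d := Unitary.linearIsometryEquiv.symm h
    have hH : Unitary.linearIsometryEquiv H = h := Unitary.linearIsometryEquiv.apply_symm_apply h
    have hHw : ∀ l, Unitary.linearIsometryEquiv H (w l) = w l := fun l => by rw [hH, hfix]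
    have hpt : ∀ U, ρ U * ENNReal.ofReal (Real.exp (-(μ * q U G))) ≤
        ρ (U * H) * ENNReal.ofReal (Real.exp (-(μ * p (U * H) G))) := by
      intro U
      have hρU : ρ (U * H) = ρ U := by
        have hiff : U * H ∈ R ↔ U ∈ R := robust_pulledBack_mul y U H w hHw
        by_cases hU : U ∈ R
        · rw [show ρ (U * H) = 1 from Set.indicator_of_mem (hiff.2 hU) 1,
            show ρ U = 1 from Set.indicator_of_mem hU 1]
        · rw [show ρ (U * H) = 0 from Set.indicator_of_notMem (fun h => hU (hiff.1 h)) 1,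
            show ρ U = 0 from Set.indicator_of_notMem hU 1]
      have hpq : p (U * H) G ≤ q U G := Finset.sum_le_sum fun i _ => by
        refine le_trans (le_of_eq (Finset.sum_congr rfl fun j _ => ?_)) (hle (z U i))
        rw [show z (U * H) i = h.symm (z U i) from by rw [← hH]; exact pulledBack_mul y U H w hHw i]
        rw [← h.inner_map_map, LinearIsometryEquiv.apply_symm_apply]
      simp only [hρU]
      gcongr
    exact (lintegral_mono hpt).trans (lintegral_mul_right_eq_self
      (fun U => ρ U * ENNReal.ofReal (Real.exp (-(μ * p U G)))) H).le
  have hanti : ∀ U, ∫⁻ G, ρ U * ENNReal.ofReal (Real.exp (-(μ * p U G))) ∂gaussianFamily d r ≤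
      ENNReal.ofReal ((Real.sqrt (2 * μ * γ ^ 2))⁻¹ ^ (k * r)) := fun U => by
    rw [lintegral_const_mul _ (hsec p hp U)]
    by_cases hU : U ∈ R
    · rw [show ρ U = 1 from Set.indicator_of_mem hU 1, one_mul]
      exact Robust.lintegral_gaussianFamily_le r hγ hμ hU hkd
    · rw [show ρ U = 0 from Set.indicator_of_notMem hU 1, zero_mul]
      exact zero_le
  have hA : MeasurableSet A := hz (isClosed_setOf_nearly_orthogonal_robust E β γ).measurableSet
  have hmain : haarOrth d A * ENNReal.ofReal (Real.exp (-(μ * (k * (4 * d * β ^ 2))))) ≤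
      ENNReal.ofReal ((Real.sqrt (2 * μ * γ ^ 2))⁻¹ ^ (k * r)) :=
    calc haarOrth d A * ENNReal.ofReal (Real.exp (-(μ * (k * (4 * d * β ^ 2)))))
        = ∫⁻ U, A.indicator 1 U * ENNReal.ofReal (Real.exp (-(μ * (k * (4 * d * β ^ 2)))))
            ∂haarOrth d := by
          rw [lintegral_mul_const _ (measurable_one.indicator hA), lintegral_indicator_one hA]
      _ ≤ ∫⁻ U, ∫⁻ G, ρ U * ENNReal.ofReal (Real.exp (-(μ * q U G))) ∂gaussianFamily d r
            ∂haarOrth d := lintegral_mono hjensen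
      _ = ∫⁻ G, ∫⁻ U, ρ U * ENNReal.ofReal (Real.exp (-(μ * q U G))) ∂haarOrth d
            ∂gaussianFamily d r := lintegral_lintegral_swap (hmeas q hq).aemeasurable
      _ ≤ ∫⁻ G, ∫⁻ U, ρ U * ENNReal.ofReal (Real.exp (-(μ * p U G))) ∂haarOrth d
            ∂gaussianFamily d r := lintegral_mono hrot
      _ = ∫⁻ U, ∫⁻ G, ρ U * ENNReal.ofReal (Real.exp (-(μ * p U G))) ∂gaussianFamily d r
            ∂haarOrth d := (lintegral_lintegral_swap (hmeas p hp).aemeasurable).symm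
      _ ≤ ∫⁻ _, ENNReal.ofReal ((Real.sqrt (2 * μ * γ ^ 2))⁻¹ ^ (k * r)) ∂haarOrth d :=
          lintegral_mono hanti
      _ = _ := by simp
  calc haarOrth d A = haarOrth d A * ENNReal.ofReal (Real.exp (-(μ * (k * (4 * d * β ^ 2))))) *
        ENNReal.ofReal (Real.exp (μ * (k * (4 * d * β ^ 2)))) := by
        rw [mul_assoc, ← ENNReal.ofReal_mul (Real.exp_pos _).le, ← Real.exp_add]
        simp
    _ ≤ ENNReal.ofReal ((Real.sqrt (2 * μ * γ ^ 2))⁻¹ ^ (k * r)) *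
        ENNReal.ofReal (Real.exp (μ * (k * (4 * d * β ^ 2)))) := by gcongr
    _ = _ := by
        rw [mul_comm, ← ENNReal.ofReal_mul (Real.exp_pos _).le]

/-- The bound for fixed samples, with explicit constants. -/
theorem haarOrth_nearly_orthogonal_le_exp {d m n k : ℕ} {β γ : ℝ} (hd : 0 < d) (hn : 0 < n)
    (hβ : 0 < β) (hγ : 0 < γ) (hkd : k ≤ d) (hratio : 144 * (d / n) ≤ (γ / β) ^ 2)
    (hm : 2 * m ≤ n) {E : Submodule ℝ (Vec d)} (hE : Module.finrank ℝ E = n) {w : Fin m → Vec d}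
    (hw : ∀ l, w l ∈ E) {y : (Fin m → Vec d) → Fin k → Vec d} (hy : Measurable y) :
    haarOrth d {U | (∀ i, ‖E.starProjection (pulledBack y U w i)‖ ≤ β) ∧
      Robust γ (pulledBack y U w)} ≤ ENNReal.ofReal (Real.exp (-(k * n / 4))) := by
  have hd' : (0 : ℝ) < d := Nat.cast_pos.2 hd
  have hn' : (0 : ℝ) < n := Nat.cast_pos.2 hn
  -- Chosen so that the Jensen loss `4 μ k d β²` equals `kn/4`, half of the guaranteed gain `kn/2`.
  set μ : ℝ := n / (16 * d * β ^ 2) with hμdef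
  have hμ : 0 < μ := by positivity
  refine (haarOrth_nearly_orthogonal_le hγ hμ hkd hw rfl hy).trans (ENNReal.ofReal_le_ofReal ?_)
  set W := Submodule.span ℝ (Set.range w)
  set r := Module.finrank ℝ ↥(Wᗮ ⊓ E)
  have hWE : W ≤ E := Submodule.span_le.2 (by rintro _ ⟨l, rfl⟩; exact hw l)
  have hr : n ≤ 2 * r := by
    have h1 := Submodule.finrank_add_inf_finrank_orthogonal hWE
    have h2 : Module.finrank ℝ W ≤ m := by
      exact (finrank_range_le_card (R := ℝ) w).trans_eq (Fintype.card_fin m)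
    omega
  -- The ratio hypothesis gives `2μγ² ≥ 144 / 8 = 18 > e²`, so each of the `k * r` factors gains at
  -- least `e`.
  have hexp : Real.exp 1 ≤ Real.sqrt (2 * μ * γ ^ 2) := by
    refine Real.le_sqrt_of_sq_le ?_
    have h1 : 2 * μ * γ ^ 2 = (γ / β) ^ 2 * (n / (8 * d)) := by
      rw [hμdef]; field_simp; ring
    have h2 : 144 * ((d : ℝ) / n) * (n / (8 * d)) = 18 := by field_simp; norm_num
    have h3 : (18 : ℝ) ≤ 2 * μ * γ ^ 2 := by
      rw [h1, ← h2]; gcongr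
    have := Real.exp_one_lt_d9
    nlinarith [Real.exp_pos 1]
  have hpow : (Real.sqrt (2 * μ * γ ^ 2))⁻¹ ^ (k * r) ≤ Real.exp (-(k * n / 2)) := by
    calc (Real.sqrt (2 * μ * γ ^ 2))⁻¹ ^ (k * r) ≤ (Real.exp 1)⁻¹ ^ (k * r) := by gcongr
      _ = Real.exp (-(k * r)) := by
          rw [← Real.exp_neg, ← Real.exp_nat_mul]; push_cast; ring_nf
      _ ≤ _ := by
          refine Real.exp_le_exp.2 ?_
          have : (n : ℝ) ≤ 2 * r := by exact_mod_cast hr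
          have : (k : ℝ) * n ≤ k * (2 * r) := by gcongr
          linarith
  calc _ ≤ Real.exp (μ * (k * (4 * d * β ^ 2))) * Real.exp (-(k * n / 2)) := by gcongr
    _ = Real.exp (-(k * n / 4)) := by
        rw [← Real.exp_add]
        congr 1
        rw [hμdef]; field_simp; ring

theorem Wins.pulledBack {d m n k : ℕ} {β γ : ℝ} {E : Gr d n} {U : Orth d}
    {y : (Fin m → Vec d) → Fin k → Vec d} {w : Fin m → Vec d}
    (h : Wins β γ (rotate U E).1 (y fun l => Unitary.linearIsometryEquiv U (w l))) :
    (∀ i, ‖E.1.starProjection (pulledBack y U w i)‖ ≤ β) ∧ Robust γ (pulledBack y U w) := by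
  refine ⟨fun i => ?_, h.robust.map (Unitary.linearIsometryEquiv U).symm⟩
  have h1 := (h i).1
  have h2 := Submodule.starProjection_map_apply (Unitary.linearIsometryEquiv U) E.1
    (y (fun l => Unitary.linearIsometryEquiv U (w l)) i)
  have h3 : ‖(rotate U E).1.starProjection (y (fun l => Unitary.linearIsometryEquiv U (w l)) i)‖ =
      ‖E.1.starProjection (OrthogonalSubspaceGame.pulledBack y U w i)‖ :=
    (congrArg norm h2).trans (LinearIsometryEquiv.norm_map _ _)
  rwa [h3] at h1

/-! ### Union bound over messages and conclusion -/

/-- The winning probability for fixed internal randomness. -/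
theorem lintegral_wins_le {d m n k : ℕ} {ι : Type*} [Fintype ι] {β γ : ℝ} (hd : 0 < d)
    (hn1 : 1 ≤ n) (hn : n ≤ d) (hβ : 0 < β) (hγ : 0 < γ) (hkd : k ≤ d)
    (hratio : 144 * (d / n) ≤ (γ / β) ^ 2) (hm : 2 * m ≤ n)
    (y : ι → (Fin m → Vec d) → Fin k → Vec d) (hy : ∀ a, Measurable (y a))
    (msg : Gr d n → (Fin m → Vec d) → ι) :
    ∫⁻ E, (Measure.pi fun _ : Fin m => uniformSphere E.1)
      {v | Wins β γ E.1 (y (msg E v) v)} ∂uniformSubspace hn ≤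
    Fintype.card ι * ENNReal.ofReal (Real.exp (-(k * n / 4))) := by
  have hE0 : (baseSubspace hn).1 ≠ ⊥ := fun h => by
    have := (baseSubspace hn).2
    rw [h, finrank_bot] at this
    omega
  have hprob := isProbabilityMeasure_uniformSphere hE0
  set ν := Measure.pi fun _ : Fin m => uniformSphere (baseSubspace hn).1
  set E := (baseSubspace hn).1
  let B : ι → Set (Orth d × (Fin m → Vec d)) := fun a =>
    {p | (∀ i, ‖E.starProjection (pulledBack (y a) p.1 p.2 i)‖ ≤ β) ∧
      Robust γ (pulledBack (y a) p.1 p.2)}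
  have hB : ∀ a, MeasurableSet (B a) := fun a =>
    (measurable_pulledBack (hy a)) (isClosed_setOf_nearly_orthogonal_robust E β γ).measurableSet
  -- Passing to the union over all messages removes the dependence on `E` through `msg`, about which
  -- nothing is assumed.
  calc _ ≤ ∫⁻ F : Gr d n, (Measure.pi fun _ : Fin m => uniformSphere F.1)
        (⋃ a, {v | Wins β γ F.1 (y a v)}) ∂uniformSubspace hn :=
        lintegral_mono fun F => measure_mono fun v hv => Set.mem_iUnion.2 ⟨msg F v, hv⟩
    _ ≤ ∫⁻ U, ν {w | (fun l => Unitary.linearIsometryEquiv U (w l)) ∈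
          ⋃ a, {v | Wins β γ (rotate U (baseSubspace hn)).1 (y a v)}} ∂haarOrth d :=
        lintegral_uniformSubspace_le hn hn1 fun F => ⋃ a, {v | Wins β γ F (y a v)}
    _ ≤ ∫⁻ U, ∑ a, ν (Prod.mk U ⁻¹' B a) ∂haarOrth d := lintegral_mono fun U => by
        refine le_trans (measure_mono ?_) (measure_iUnion_fintype_le ν fun a => Prod.mk U ⁻¹' B a)
        intro w hw
        obtain ⟨a, ha⟩ := Set.mem_iUnion.1 hw
        exact Set.mem_iUnion.2 ⟨a, Wins.pulledBack ha⟩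
    _ = ∑ a, ∫⁻ U, ν (Prod.mk U ⁻¹' B a) ∂haarOrth d :=
        lintegral_finsetSum _ fun a _ => measurable_measure_prodMk_left (hB a)
    _ ≤ ∑ _a : ι, ENNReal.ofReal (Real.exp (-(k * n / 4))) := Finset.sum_le_sum fun a _ => by
        -- Fubini: the samples `w` are fixed outside, and the Haar bound applies to `U` inside.
        rw [← Measure.prod_apply (hB a), Measure.prod_apply_symm (hB a)]
        calc _ ≤ ∫⁻ _, ENNReal.ofReal (Real.exp (-(k * n / 4))) ∂ν := by
              refine lintegral_mono_ae ?_
              filter_upwards [ae_mem_of_pi_uniformSphere hE0] with w hw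
              exact haarOrth_nearly_orthogonal_le_exp hd hn1 hβ hγ hkd hratio hm
                (baseSubspace hn).2 hw (hy a)
          _ = _ := by simp
    _ = _ := by simp

end OrthogonalSubspaceGame

theorem mainTheorem6 {Ω : Type*} [MeasurableSpace Ω] (P : Measure Ω) [IsProbabilityMeasure P]
    (d n m M k : ℕ) (hd : 8 ≤ d) (hn1 : 1 ≤ n) (hn : n ≤ d) (C β γ : ℝ) (hC : 1 ≤ C)
    (hβ0 : 0 < β) (hβ1 : β ≤ 1) (hγ0 : 0 < γ) (hγ1 : γ ≤ 1)
    (hratio : 12 * Real.sqrt ((k : ℝ) * d / n) ≤ γ / β)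
    (hk_upper : (k : ℝ) ≤ (n : ℝ) / 4)
    (hk_lower : 50 * C * (((M : ℝ) + 2) / n) * Real.log (Real.sqrt d / γ) ≤ k)
    (S : OrthogonalSubspaceGame.Strategy Ω d n m M k)
    (hwin : ENNReal.ofReal (1 / C) ≤ OrthogonalSubspaceGame.winProb P hn S β γ) :
    (n : ℝ) / 2 ≤ m := by
  by_contra hcon
  push Not at hcon
  have hm : 2 * m ≤ n := by
    have : (2 : ℝ) * m ≤ n := by linarith
    exact_mod_cast this
  have hn' : (0 : ℝ) < n := Nat.cast_pos.2 hn1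
  have hd8 : (8 : ℝ) ≤ d := by exact_mod_cast hd
  have hM : (0 : ℝ) ≤ M := M.cast_nonneg
  -- Uses `d ≥ 8 > e²` and `γ ≤ 1`.
  have hlog : 1 ≤ Real.log (Real.sqrt d / γ) := by
    rw [Real.le_log_iff_exp_le (by positivity)]
    calc Real.exp 1 ≤ Real.sqrt d := by
          refine Real.le_sqrt_of_sq_le ?_
          have := Real.exp_one_lt_d9
          nlinarith [Real.exp_pos 1]
      _ ≤ Real.sqrt d / γ := le_div_self (Real.sqrt_nonneg _) hγ0 hγ1
  have hkn : 50 * C * (M + 2) ≤ k * n := by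
    have h1 : 50 * C * (((M : ℝ) + 2) / n) ≤ k :=
      le_trans (le_mul_of_one_le_right (by positivity) hlog) hk_lower
    calc 50 * C * ((M : ℝ) + 2) = 50 * C * (((M : ℝ) + 2) / n) * n := by field_simp
      _ ≤ k * n := by gcongr
  have hk1 : (1 : ℝ) ≤ k := by
    have : k ≠ 0 := by
      rintro rfl
      have : 0 < 50 * C * ((M : ℝ) + 2) := by positivity
      simp at hkn
      linarith
    exact_mod_cast Nat.one_le_iff_ne_zero.2 this
  have hkd : k ≤ d := by
    have h1 : (k : ℝ) ≤ n := by linarith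
    exact (Nat.cast_le.1 h1).trans hn
  have hratio' : 144 * ((d : ℝ) / n) ≤ (γ / β) ^ 2 := by
    have h1 := pow_le_pow_left₀ (by positivity) hratio 2
    rw [mul_pow, Real.sq_sqrt (by positivity), mul_div_assoc] at h1
    have h2 : (d : ℝ) / n ≤ k * (d / n) := le_mul_of_one_le_left (by positivity) hk1
    linarith
  have hle : OrthogonalSubspaceGame.winProb P hn S β γ ≤
      ENNReal.ofReal (2 ^ M * Real.exp (-(k * n / 4))) := by
    have hω : ∀ ω, ∫⁻ E, (Measure.pi fun _ : Fin m => OrthogonalSubspaceGame.uniformSphere E.1)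
        {v | OrthogonalSubspaceGame.Wins β γ E.1 (S.output ω (S.message ω E v) v)}
        ∂(OrthogonalSubspaceGame.uniformSubspace hn) ≤
        ENNReal.ofReal (2 ^ M * Real.exp (-(k * n / 4))) := fun ω => by
      refine (OrthogonalSubspaceGame.lintegral_wins_le (by omega) hn1 hn hβ0 hγ0 hkd hratio' hm
        (S.output ω) (fun a => S.measurable_output.comp
          (measurable_const.prodMk (measurable_const.prodMk measurable_id)))
        (S.message ω)).trans (le_of_eq ?_)
      rw [ENNReal.ofReal_mul (by positivity)]
      simp
    refine (lintegral_mono hω).trans (le_of_eq ?_)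
    simp
  have hfin : 1 / C ≤ 2 ^ M * Real.exp (-(k * n / 4)) :=
    (ENNReal.ofReal_le_ofReal_iff (by positivity)).1 (hwin.trans hle)
  have h2 : (2 : ℝ) ^ M ≤ Real.exp M := by
    rw [← mul_one (M : ℝ), Real.exp_nat_mul]
    exact pow_le_pow_left₀ (by norm_num) (by linarith [Real.add_one_le_exp (1 : ℝ)]) M
  -- By `hkn`, `kn/4 ≥ 12.5 C (M + 2)`, which exceeds `M + C` because `C ≥ 1`.
  have h3 : (2 : ℝ) ^ M * Real.exp (-(k * n / 4)) ≤ Real.exp (-C) := by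
    calc (2 : ℝ) ^ M * Real.exp (-(k * n / 4)) ≤ Real.exp M * Real.exp (-(k * n / 4)) := by gcongr
      _ = Real.exp (M + -(k * n / 4)) := (Real.exp_add _ _).symm
      _ ≤ _ := by
          refine Real.exp_le_exp.2 ?_
          nlinarith [mul_nonneg (sub_nonneg.2 hC) hM]
  have h4 : Real.exp (-C) < 1 / C := by
    rw [Real.exp_neg, ← one_div]
    exact one_div_lt_one_div_of_lt (by linarith) (by linarith [Real.add_one_le_exp C])
  linarith
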